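/- Let $\alpha_0=3-2\sqrt2$. For an infinitely differentiable function $f:\mathbb R\to\mathbb R$, call $z\in\mathbb R$ an approximate zero of $f$ if it passes Smale's $\alpha$-test, i.e. $f'(z)\neq0$, $\gamma(f,z)<\infty$ and \[ \alpha(f,z)=\beta(f,z)\,\gamma(f,z)<\alpha_0,\qquad \beta(f,z)=\left|\frac{f(z)}{f'(z)}\right|,\qquad \gamma(f,z)=\sup_{k\ge2}\left|\frac{f^{(k)}(z)}{k!\,f'(z)}\right|^{\frac1{k-1}}. \] For $g\in(0,1)$ and $L\in[0,\infty)$ let $f_{g,L}(S)=S-g\,\operatorname{asinh}(S)-L$ and define \[ \widetilde S(g,L)=\begin{cases} L+2.30\,g & \text{if } 4-1.9\,g<L,\\ L+1.90\,g & \text{if } 2.74-1.56\,g<L\le 4-1.9\,g,\\ L+1.56\,g & \text{if } 2.01-1.33\,g<L\le 2.74-1.56\,g,\\ L+1.33\,g & \text{if } 1.60-1.16\,g<L\le 2.01-1.33\,g,\\ L+1.16\,g & \text{if } 1.32-1.02\,g<L\le 1.60-1.16\,g,\\ L+1.02\,g & \text{if } 1.12-0.91\,g<L\le 1.32-1.02\,g,\\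 L+0.91\,g & \text{if } 1-\frac56\,g<L\le 1.12-0.91\,g,\\ \text{the real solution } S \text{ of } (1-g)S+g\frac{S^3}{6}=L & \text{if } 0\le L\le 1-\frac56\,g. \end{cases} \] Then, for all $g\in(0,1)$ and $L\in[0,\infty)$, the cubic equation in the last case has exactly one real solution whenever that case applies, and $\widetilde S(g,L)$ is an approximate zero of $f_{g,L}$. -/

import Mathlib

open scoped Nat ContDiff

noncomputable section

namespace HyperbolicKepler

/-- The constant `α₀ = 3 - 2√2`. -/
def alphaZero : ℝ := 3 - 2 * Real.sqrt 2

/-- `β(f,z) = |f(z) / f'(z)|`. -/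
def beta (f : ℝ → ℝ) (z : ℝ) : ℝ := |f z / deriv f z|

/-- The `k`-th term `|f⁽ᵏ⁾(z) / (k! f'(z))|^{1/(k-1)}` in the definition of `γ(f,z)`; it is used
only for `k ≥ 2`. -/
def gammaTerm (f : ℝ → ℝ) (z : ℝ) (k : ℕ) : ℝ :=
  |iteratedDeriv k f z / ((k ! : ℝ) * deriv f z)| ^ (1 / ((k : ℝ) - 1))

/-- `γ(f,z)`, the supremum over `k ≥ 2` of the terms above. It is meaningful when these terms are
bounded above, which `IsApproximateZero` requires. -/
def gamma (f : ℝ → ℝ) (z : ℝ) : ℝ := sSup (gammaTerm f z '' Set.Ici 2)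

/-- `α(f,z) = β(f,z) · γ(f,z)`. -/
def alpha (f : ℝ → ℝ) (z : ℝ) : ℝ := beta f z * gamma f z

/-- Smale's `α`-test for a smooth function on the real line: `z` is an approximate zero of `f` when
`α(f,z) < α₀`. The conditions that make `β(f,z)` and `γ(f,z)` well-defined finite numbers,
namely `f'(z) ≠ 0` and the finiteness of the supremum, are part of the test. -/
structure IsApproximateZero (f : ℝ → ℝ) (z : ℝ) : Prop where
  smooth : ContDiff ℝ ∞ f
  deriv_ne_zero : deriv f z ≠ 0
  bddAbove : BddAbove (gammaTerm f z '' Set.Ici 2)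
  alpha_lt : alpha f z < alphaZero

/-- The function `f_{g,L}(S) = S - g asinh(S) - L` of the hyperbolic Kepler equation. -/
def kepler (g L : ℝ) (S : ℝ) : ℝ := S - g * Real.arsinh S - L

/-- `S` is a real solution of the cubic equation `(1-g) S + g S³/6 = L`. -/
def IsCubicRoot (g L S : ℝ) : Prop := (1 - g) * S + g * (S ^ 3 / 6) = L

/-- The real solution of the cubic equation, chosen among all solutions; the theorem also
asserts that there is exactly one where the starter uses it. -/
def cubicRoot (g L : ℝ) : ℝ := Classical.epsilon (IsCubicRoot g L)

/-- The piecewise starter. Each `else` branch carries the negation of the conditions above it as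
the upper bound on `L`, so the last branch is the region `L ≤ 1 - (5/6) g`. -/
def starter (g L : ℝ) : ℝ :=
  if 4 - 1.9 * g < L then L + 2.30 * g
  else if 2.74 - 1.56 * g < L then L + 1.90 * g
  else if 2.01 - 1.33 * g < L then L + 1.56 * g
  else if 1.60 - 1.16 * g < L then L + 1.33 * g
  else if 1.32 - 1.02 * g < L then L + 1.16 * g
  else if 1.12 - 0.91 * g < L then L + 1.02 * g
  else if 1 - 5 / 6 * g < L then L + 0.91 * g
  else cubicRoot g L

end HyperbolicKepler

end

namespace HyperbolicKepler

/-! Write `r = √(1 + z²)`, so that `f'(z) = (r - g)/r`. The derivatives of `arsinh` are Legendre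
polynomials in `z/r` up to scaling, whence `|arsinh⁽ᵏ⁾(z)| ≤ (k-1)!/rᵏ`. This gives `γ ≤ M/r` and `α
≤ |f(z)| M/(r - g)` for any `M ≥ 1` satisfying two elementary inequalities, one for `k = 2` and one
for `k ≥ 3`.

For `z = L + c g` one has `f(z) = g (c - arsinh z)`. With `M = 1` and `g (r - 1) ≤ r - g`, it
suffices that `|c - arsinh z| ≤ 0.17 (r - 1)`, which no longer involves `g` and is checked
numerically on each range of `z`.

For the cubic root, `|f(z)| = g |arsinh z - (z - z³/6)| ≤ 0.07 g z³` on `[0, 1]`. With `M = 1/z` and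
`g z² ≤ (r + 1)(r - g)`, this gives `α ≤ 0.07 (1 + √2) < α₀`. -/

/-! ### Derivatives of `arsinh` -/

theorem hasDerivAt_sqrt_one_add_sq (t : ℝ) :
    HasDerivAt (fun t : ℝ => √(1 + t ^ 2)) (t / √(1 + t ^ 2)) t := by
  have h : HasDerivAt (fun t : ℝ => 1 + t ^ 2) (2 * t) t := by
    simpa using ((hasDerivAt_id t).pow 2).const_add 1
  have h2 := h.sqrt (by positivity)
  convert h2 using 1
  field_simp

/-- Higher derivatives of `arsinh`. The functions `p` and `s` are, up to sign conventions,
`P_{n+1}(x)` and `√(1-x²) P_{n+1}'(x) / (n+1)` with `x = t / √(1+t²)` and `P_{n+1}` the Legendre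
polynomial. Passing from `n` to `n + 1` rotates `(p, (n+1)/(n+2) s)`, whence `p² + s² ≤ 1`. -/
theorem exists_iteratedDeriv_arsinh (n : ℕ) : ∃ p s : ℝ → ℝ,
    (∀ t, iteratedDeriv (n + 2) Real.arsinh t =
      (-1) ^ (n + 1) * ((n + 1) ! : ℝ) * p t / √(1 + t ^ 2) ^ (n + 2)) ∧
    (∀ t, p t ^ 2 + s t ^ 2 ≤ 1) ∧
    (∀ t, HasDerivAt p ((n + 1) * s t / (1 + t ^ 2)) t) ∧
    (∀ t, HasDerivAt s ((t * s t - (n + 2) * p t) / (1 + t ^ 2)) t) := by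
  induction n with
  | zero =>
    have hd1 : deriv Real.arsinh = fun t => (√(1 + t ^ 2))⁻¹ :=
      funext fun t => (Real.hasDerivAt_arsinh t).deriv
    refine ⟨fun t => t / √(1 + t ^ 2), fun t => (√(1 + t ^ 2))⁻¹, fun t => ?_, fun t => ?_,
      fun t => ?_, fun t => ?_⟩
    all_goals
      have hr : 0 < √(1 + t ^ 2) := by positivity
      have hr2 : √(1 + t ^ 2) ^ 2 = 1 + t ^ 2 := Real.sq_sqrt (by positivity)
      have hρ := hasDerivAt_sqrt_one_add_sq t
    · rw [zero_add, iteratedDeriv_succ, iteratedDeriv_one, hd1, (hρ.fun_inv hr.ne').deriv]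
      simp
    · refine le_of_eq ?_
      simp only
      generalize √(1 + t ^ 2) = r at *
      field_simp
      linarith
    · refine ((hasDerivAt_id t).div hρ hr.ne').congr_deriv ?_
      simp only [id]
      generalize √(1 + t ^ 2) = r at *
      rw [← hr2]
      field_simp
      push_cast
      linear_combination hr2
    · refine (hρ.inv hr.ne').congr_deriv ?_
      beta_reduce
      generalize √(1 + t ^ 2) = r at *
      rw [← hr2]
      field_simp
      push_cast
      ring
  | succ n ih =>
    obtain ⟨p, s, hD, hps, hp, hs⟩ := ih
    refine ⟨fun t => t / √(1 + t ^ 2) * p t - (n + 1) / (n + 2) * (s t / √(1 + t ^ 2)),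
      fun t => p t / √(1 + t ^ 2) + (n + 1) / (n + 2) * (t / √(1 + t ^ 2) * s t),
      fun t => ?_, fun t => ?_, fun t => ?_, fun t => ?_⟩
    all_goals
      have hr : 0 < √(1 + t ^ 2) := by positivity
      have hr2 : √(1 + t ^ 2) ^ 2 = 1 + t ^ 2 := Real.sq_sqrt (by positivity)
      have hρ := hasDerivAt_sqrt_one_add_sq t
      have hp := hp t
      have hs := hs t
      have hn : (0 : ℝ) < n + 2 := by positivity
    · rw [show n + 1 + 2 = (n + 2) + 1 by ring, iteratedDeriv_succ, funext hD]
      have h := (hp.const_mul ((-1) ^ (n + 1) * ((n + 1) ! : ℝ))).div (hρ.pow (n + 2))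
        (pow_pos hr _).ne'
      refine h.deriv.trans ?_
      simp only [Pi.pow_apply]
      generalize √(1 + t ^ 2) = r at *
      rw [← hr2]
      rw [Nat.factorial_succ (n + 1)]
      push_cast
      field_simp
      ring
    · have hps := hps t
      have e : (t / √(1 + t ^ 2) * p t - (n + 1) / (n + 2) * (s t / √(1 + t ^ 2))) ^ 2 +
          (p t / √(1 + t ^ 2) + (n + 1) / (n + 2) * (t / √(1 + t ^ 2) * s t)) ^ 2 =
          p t ^ 2 + ((n + 1) / (n + 2)) ^ 2 * s t ^ 2 := by
        generalize √(1 + t ^ 2) = r at *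
        field_simp
        rw [hr2]
        ring
      have h1 : (((n : ℝ) + 1) / (n + 2)) ^ 2 ≤ 1 := by
        apply pow_le_one₀ (by positivity)
        rw [div_le_one hn]
        linarith
      rw [e]
      nlinarith [sq_nonneg (s t)]
    · have hx := (hasDerivAt_id t).div hρ hr.ne'
      refine ((hx.mul hp).sub
        ((hs.div hρ hr.ne').const_mul (((n : ℝ) + 1) / (n + 2)))).congr_deriv ?_
      simp only [id, Pi.div_apply]
      generalize √(1 + t ^ 2) = r at *
      rw [← hr2]
      have ht : t ^ 2 = r ^ 2 - 1 := by linarith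
      push_cast
      field_simp
      ring_nf
      rw [ht]
      ring
    · have hx := (hasDerivAt_id t).div hρ hr.ne'
      refine ((hp.div hρ hr.ne').add
        ((hx.mul hs).const_mul (((n : ℝ) + 1) / (n + 2)))).congr_deriv ?_
      simp only [id, Pi.div_apply]
      generalize √(1 + t ^ 2) = r at *
      rw [← hr2]
      have ht : t ^ 2 = r ^ 2 - 1 := by linarith
      push_cast
      field_simp
      ring_nf
      rw [ht]
      ring

theorem abs_iteratedDeriv_arsinh_le (n : ℕ) (t : ℝ) :
    |iteratedDeriv (n + 2) Real.arsinh t| ≤ ((n + 1) ! : ℝ) / √(1 + t ^ 2) ^ (n + 2) := by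
  obtain ⟨p, s, hD, hps, -, -⟩ := exists_iteratedDeriv_arsinh n
  have hp : |p t| ≤ 1 := by
    rw [← sq_le_one_iff_abs_le_one]
    nlinarith [hps t, sq_nonneg (s t)]
  rw [hD, abs_div, abs_mul, abs_mul, abs_pow, abs_neg, abs_one, one_pow, one_mul,
    abs_of_pos (by positivity : (0 : ℝ) < √(1 + t ^ 2) ^ (n + 2)), Nat.abs_cast]
  gcongr
  exact mul_le_of_le_one_right (by positivity) hp

/-- The general bound would lose the factor `|t|/√(1 + t²)`, which is indispensable for small cubic
roots when `g` is near `1`. -/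
theorem iteratedDeriv_two_arsinh (t : ℝ) :
    iteratedDeriv 2 Real.arsinh t = -(t / √(1 + t ^ 2) ^ 3) := by
  have hd1 : deriv Real.arsinh = fun t => (√(1 + t ^ 2))⁻¹ :=
    funext fun t => (Real.hasDerivAt_arsinh t).deriv
  have hr : 0 < √(1 + t ^ 2) := by positivity
  rw [iteratedDeriv_succ, iteratedDeriv_one, hd1,
    ((hasDerivAt_sqrt_one_add_sq t).fun_inv hr.ne').deriv]
  field_simp

/-! ### The `α`-test for the Kepler function -/

theorem hasDerivAt_kepler (g L t : ℝ) :
    HasDerivAt (kepler g L) (1 - g * (√(1 + t ^ 2))⁻¹) t :=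
  ((hasDerivAt_id t).sub ((Real.hasDerivAt_arsinh t).const_mul g)).sub_const L

theorem iteratedDeriv_kepler (g L t : ℝ) (n : ℕ) :
    iteratedDeriv (n + 2) (kepler g L) t = -(g * iteratedDeriv (n + 2) Real.arsinh t) := by
  have h : deriv (kepler g L) = fun t => 1 - g * deriv Real.arsinh t := by
    funext t
    rw [(hasDerivAt_kepler g L t).deriv, (Real.hasDerivAt_arsinh t).deriv]
  rw [iteratedDeriv_succ', h, iteratedDeriv_const_sub n.succ_pos, iteratedDeriv_neg,
    iteratedDeriv_const_mul_field, ← iteratedDeriv_succ']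

theorem contDiff_kepler (g L : ℝ) : ContDiff ℝ ∞ (kepler g L) :=
  (contDiff_id.sub (contDiff_const.mul Real.contDiff_arsinh)).sub contDiff_const

theorem one_le_sqrt_one_add_sq (z : ℝ) : 1 ≤ √(1 + z ^ 2) :=
  Real.one_le_sqrt.2 (by nlinarith [sq_nonneg z])

/-- A bound on the terms of `γ(f_{g,L}, z)`: the term `k = 2` is treated exactly, the others
through the bound on the Legendre polynomials. -/
theorem gammaTerm_kepler_le {g L z M : ℝ} (hg : g ∈ Set.Ioo (0 : ℝ) 1) (hM : 1 ≤ M)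
    (h2 : g * |z| ≤ 2 * M * √(1 + z ^ 2) * (√(1 + z ^ 2) - g))
    (h3 : g ≤ 3 * M ^ 2 * (√(1 + z ^ 2) - g)) {k : ℕ} (hk : 2 ≤ k) :
    gammaTerm (kepler g L) z k ≤ M / √(1 + z ^ 2) := by
  obtain ⟨n, rfl⟩ := Nat.exists_eq_add_of_le' hk
  have hρ := one_le_sqrt_one_add_sq z
  have hg0 : 0 < g := hg.1
  have hd : 0 < √(1 + z ^ 2) - g := by linarith [hg.2]
  suffices h : |iteratedDeriv (n + 2) (kepler g L) z / (((n + 2) ! : ℝ) * deriv (kepler g L) z)| ≤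
      (M / √(1 + z ^ 2)) ^ (n + 1) by
    have e : 1 / (((n + 2 : ℕ) : ℝ) - 1) = ((n + 1 : ℕ) : ℝ)⁻¹ := by
      push_cast
      rw [one_div]
      congr 1
      ring
    rw [gammaTerm, e]
    refine (Real.rpow_le_rpow (abs_nonneg _) h (by positivity)).trans_eq ?_
    exact Real.pow_rpow_inv_natCast (by positivity) (by simp)
  rw [iteratedDeriv_kepler, (hasDerivAt_kepler g L z).deriv]
  have hden : 1 - g * (√(1 + z ^ 2))⁻¹ = (√(1 + z ^ 2) - g) / √(1 + z ^ 2) := by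
    field_simp
  have hdpos : 0 < (√(1 + z ^ 2) - g) / √(1 + z ^ 2) := by positivity
  rw [hden, abs_div, abs_neg, abs_mul, abs_of_pos hg0, abs_mul, abs_of_pos hdpos, Nat.abs_cast]
  rcases n with _ | n
  · rw [zero_add, iteratedDeriv_two_arsinh, abs_neg, abs_div,
      abs_of_pos (by positivity : (0 : ℝ) < √(1 + z ^ 2) ^ 3)]
    generalize √(1 + z ^ 2) = r at *
    generalize |z| = w at *
    have hr0 : 0 < r := by linarith
    rw [div_le_iff₀ (by positivity), Nat.factorial_two]
    push_cast
    rw [show (M / r) ^ (0 + 1) * (2 * ((r - g) / r)) = 2 * M * r * (r - g) / r ^ 3 by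
      rw [zero_add, pow_one]; field_simp, mul_div_assoc']
    gcongr
  · have hb := abs_iteratedDeriv_arsinh_le (n + 1) z
    generalize √(1 + z ^ 2) = r at *
    rw [div_le_iff₀ (by positivity)]
    refine (mul_le_mul_of_nonneg_left hb hg0.le).trans ?_
    -- The condition for order `k` is `g ≤ k M^(k-1) (r - g)`; since `M ≥ 1`, it is strongest at `k
    -- = 3`, which is `h3`.
    have hMp : M ^ 2 ≤ M ^ (n + 2) := pow_le_pow_right₀ hM (by lia)
    have key : g ≤ M ^ (n + 2) * ((n + 3) * (r - g)) :=
      calc g ≤ 3 * M ^ 2 * (r - g) := h3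
        _ = M ^ 2 * (3 * (r - g)) := by ring
        _ ≤ M ^ (n + 2) * ((n + 3) * (r - g)) := by
          gcongr
          linarith [(Nat.cast_nonneg n : (0 : ℝ) ≤ n)]
    rw [show n + 1 + 2 = (n + 2) + 1 by ring, show n + 1 + 1 = n + 2 by ring,
      Nat.factorial_succ (n + 2), div_pow, pow_succ r (n + 2)]
    push_cast
    calc g * (((n + 2) ! : ℝ) / (r ^ (n + 2) * r))
        ≤ (M ^ (n + 2) * ((n + 3) * (r - g))) * (((n + 2) ! : ℝ) / (r ^ (n + 2) * r)) := by gcongr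
      _ = _ := by
        field_simp
        ring

theorem isApproximateZero_kepler {g L z M : ℝ} (hg : g ∈ Set.Ioo (0 : ℝ) 1) (hM : 1 ≤ M)
    (h2 : g * |z| ≤ 2 * M * √(1 + z ^ 2) * (√(1 + z ^ 2) - g))
    (h3 : g ≤ 3 * M ^ 2 * (√(1 + z ^ 2) - g))
    (hα : |kepler g L z| * M < alphaZero * (√(1 + z ^ 2) - g)) :
    IsApproximateZero (kepler g L) z := by
  have hρ := one_le_sqrt_one_add_sq z
  have hd : 0 < √(1 + z ^ 2) - g := by linarith [hg.2]
  have hden : deriv (kepler g L) z = (√(1 + z ^ 2) - g) / √(1 + z ^ 2) := by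
    rw [(hasDerivAt_kepler g L z).deriv]
    field_simp
  have hdpos : 0 < (√(1 + z ^ 2) - g) / √(1 + z ^ 2) := by positivity
  have hub : ∀ y ∈ gammaTerm (kepler g L) z '' Set.Ici 2, y ≤ M / √(1 + z ^ 2) := by
    rintro _ ⟨k, hk, rfl⟩
    exact gammaTerm_kepler_le hg hM h2 h3 hk
  refine ⟨contDiff_kepler g L, hden ▸ hdpos.ne', ⟨_, hub⟩, ?_⟩
  have hγ : gamma (kepler g L) z ≤ M / √(1 + z ^ 2) :=
    csSup_le (Set.Nonempty.image _ Set.nonempty_Ici) hub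
  calc alpha (kepler g L) z ≤ beta (kepler g L) z * (M / √(1 + z ^ 2)) :=
        mul_le_mul_of_nonneg_left hγ (abs_nonneg _)
    _ = |kepler g L z| * M / (√(1 + z ^ 2) - g) := by
        rw [beta, hden, abs_div, abs_of_pos hdpos]
        field_simp
    _ < alphaZero := by rwa [div_lt_iff₀ hd]

/-! ### Linear starters -/

theorem alphaZero_gt : 0.1715 < alphaZero := by
  have : √2 < 1.41425 := by
    rw [Real.sqrt_lt' (by norm_num)]
    norm_num
  rw [alphaZero]
  linarith

/-- The criterion for starters of the form `L + c g` that are at least `1`. -/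
theorem isApproximateZero_of_abs_sub_arsinh_le {g L c z : ℝ} (hg : g ∈ Set.Ioo (0 : ℝ) 1)
    (hz : z = L + c * g) (h1 : 1 ≤ z)
    (h : |c - Real.arsinh z| ≤ 0.17 * (√(1 + z ^ 2) - 1)) :
    IsApproximateZero (kepler g L) z := by
  have hr2 : √(1 + z ^ 2) ^ 2 = 1 + z ^ 2 := Real.sq_sqrt (by positivity)
  have hr : 1.4 ≤ √(1 + z ^ 2) := Real.le_sqrt_of_sq_le (by nlinarith)
  have hk : kepler g L z = g * (c - Real.arsinh z) := by
    rw [kepler, hz]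
    ring
  obtain ⟨hg0, hg1⟩ := hg
  have hα := alphaZero_gt
  apply isApproximateZero_kepler (M := 1) ⟨hg0, hg1⟩ le_rfl
  · rw [abs_of_nonneg (by linarith)]
    generalize √(1 + z ^ 2) = r at *
    have hzr : z ≤ 2 * r * (r - 1) := by
      refine (sq_le_sq₀ (by linarith) (by nlinarith)).1 ?_
      have : z ^ 2 = r ^ 2 - 1 := by linarith
      rw [this]
      have : r + 1 ≤ 4 * r ^ 2 * (r - 1) := by nlinarith
      nlinarith
    nlinarith
  · linarith
  · rw [hk, abs_mul, abs_of_pos hg0, mul_one]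
    generalize √(1 + z ^ 2) = r at *
    have : g * |c - Real.arsinh z| ≤ g * (0.17 * (r - 1)) := by gcongr
    nlinarith

/-- Since `exp (arsinh z) = z + √(1 + z²)`, comparing `arsinh z` with `p/q` means comparing a `q`-th
power with `e^p`, a rational computation once `e > 2.718`. -/
theorem arsinh_le_div {z r : ℝ} (p q : ℕ) (hq : 0 < q) (hr : √(1 + z ^ 2) ≤ r - z)
    (h : r ^ q ≤ 2.718 ^ p) : Real.arsinh z ≤ p / q := by
  rw [le_div_iff₀ (by positivity), ← Real.exp_le_exp, mul_comm, Real.exp_nat_mul,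
    Real.exp_arsinh, ← mul_one (p : ℝ), Real.exp_nat_mul]
  have h0 : 0 < z + √(1 + z ^ 2) := Real.exp_arsinh z ▸ Real.exp_pos _
  calc (z + √(1 + z ^ 2)) ^ q ≤ r ^ q := by
        gcongr
        linarith
    _ ≤ 2.718 ^ p := h
    _ ≤ Real.exp 1 ^ p := by
        gcongr
        linarith [Real.exp_one_gt_d9]

theorem div_le_arsinh {z r : ℝ} (p q : ℕ) (hq : 0 < q) (hr0 : 0 ≤ r) (hr : r - z ≤ √(1 + z ^ 2))
    (h : 2.719 ^ p ≤ r ^ q) : p / q ≤ Real.arsinh z := by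
  rw [div_le_iff₀ (by positivity), ← Real.exp_le_exp, mul_comm (Real.arsinh z), Real.exp_nat_mul,
    Real.exp_arsinh, ← mul_one (p : ℝ), Real.exp_nat_mul]
  calc Real.exp 1 ^ p ≤ 2.719 ^ p := by
        gcongr
        linarith [Real.exp_one_lt_d9]
    _ ≤ r ^ q := h
    _ ≤ (z + √(1 + z ^ 2)) ^ q := by
        gcongr
        linarith

/-- Both `arsinh z` and `√(1 + z²)` increase for `z ≥ 0`, so rational bounds at the endpoints
control the whole interval. -/
theorem abs_sub_arsinh_le {c z lo hi a b r : ℝ} (hlo0 : 0 ≤ lo) (hlo : lo ≤ z) (hhi : z ≤ hi)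
    (ha : a ≤ Real.arsinh lo) (hb : Real.arsinh hi ≤ b) (hr : r ^ 2 ≤ 1 + lo ^ 2)
    (hca : c - a ≤ 0.17 * (r - 1)) (hbc : b - c ≤ 0.17 * (r - 1)) :
    |c - Real.arsinh z| ≤ 0.17 * (√(1 + z ^ 2) - 1) := by
  have h1 := ha.trans (Real.arsinh_le_arsinh.2 hlo)
  have h2 := (Real.arsinh_le_arsinh.2 hhi).trans hb
  have h3 : r ≤ √(1 + z ^ 2) := Real.le_sqrt_of_sq_le (by nlinarith)
  rw [abs_le]
  constructor <;> linarith

theorem abs_sub_arsinh_le_of_four_le {z : ℝ} (hz : 4 ≤ z) (h4 : 2 ≤ Real.arsinh 4) :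
    |2.30 - Real.arsinh z| ≤ 0.17 * (√(1 + z ^ 2) - 1) := by
  have h1 := h4.trans (Real.arsinh_le_arsinh.2 hz)
  have h3 : z ≤ √(1 + z ^ 2) := Real.le_sqrt_of_sq_le (by linarith)
  have he : 20 ≤ Real.exp 3 := by
    rw [show (3 : ℝ) = (3 : ℕ) * 1 by norm_num, Real.exp_nat_mul]
    calc (20 : ℝ) ≤ 2.718 ^ 3 := by norm_num
      _ ≤ _ := by
        gcongr
        linarith [Real.exp_one_gt_d9]
  -- The range is unbounded: `x + 1 ≤ exp x` at `x = arsinh z - 3` gives linear growth with slope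
  -- below `0.17`.
  have h5 : Real.arsinh z - 2 ≤ (z + √(1 + z ^ 2)) / 20 :=
    calc Real.arsinh z - 2 = (Real.arsinh z - 3) + 1 := by ring
      _ ≤ Real.exp (Real.arsinh z - 3) := Real.add_one_le_exp _
      _ = (z + √(1 + z ^ 2)) / Real.exp 3 := by rw [Real.exp_sub, Real.exp_arsinh]
      _ ≤ _ := by gcongr
  rw [abs_le]
  constructor <;> linarith

/-! ### The cubic starter -/

theorem sub_cube_le_arsinh {z : ℝ} (hz : 0 ≤ z) : z - z ^ 3 / 6 ≤ Real.arsinh z := by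
  have hd : ∀ t, HasDerivAt (fun t : ℝ => Real.arsinh t - (t - t ^ 3 / 6))
      ((√(1 + t ^ 2))⁻¹ - (1 - t ^ 2 / 2)) t := fun t => by
    have := (Real.hasDerivAt_arsinh t).sub ((hasDerivAt_id t).sub
      (((hasDerivAt_id t).pow 3).div_const 6))
    refine this.congr_deriv ?_
    simp
    ring
  have hm : MonotoneOn (fun t : ℝ => Real.arsinh t - (t - t ^ 3 / 6)) (Set.Ici 0) := by
    refine monotoneOn_of_hasDerivWithinAt_nonneg (convex_Ici 0)
      (fun t _ => (hd t).continuousAt.continuousWithinAt) (fun t _ => (hd t).hasDerivWithinAt) ?_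
    intro t _
    have hr2 : √(1 + t ^ 2) ^ 2 = 1 + t ^ 2 := Real.sq_sqrt (by positivity)
    have hr := one_le_sqrt_one_add_sq t
    generalize √(1 + t ^ 2) = r at *
    have ht : t ^ 2 = r ^ 2 - 1 := by linarith
    rw [ht, sub_nonneg, ← one_div, le_div_iff₀ (by linarith)]
    -- The claim is `r³ - 3r + 2 = (r - 1)² (r + 2) ≥ 0`.
    nlinarith [mul_nonneg (sq_nonneg (r - 1)) (by linarith : 0 ≤ r + 2)]
  have := hm (Set.mem_Ici.2 le_rfl) (Set.mem_Ici.2 hz) hz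
  simp at this
  linarith

/-- The constant `0.07` has little slack: comparing derivatives at `1` needs about `0.069`, and the
`α`-test needs less than `α₀/(1 + √2) ≈ 0.071`. -/
theorem arsinh_le_sub_cube {z : ℝ} (hz : 0 ≤ z) (hz1 : z ≤ 1) :
    Real.arsinh z ≤ z - z ^ 3 / 6 + 0.07 * z ^ 3 := by
  have hd : ∀ t, HasDerivAt (fun t : ℝ => t - t ^ 3 / 6 + 0.07 * t ^ 3 - Real.arsinh t)
      (1 - 0.29 * t ^ 2 - (√(1 + t ^ 2))⁻¹) t := fun t => by
    have := (((hasDerivAt_id t).sub (((hasDerivAt_id t).pow 3).div_const 6)).add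
      (((hasDerivAt_id t).pow 3).const_mul 0.07)).sub (Real.hasDerivAt_arsinh t)
    refine this.congr_deriv ?_
    simp
    ring
  have hm : MonotoneOn (fun t : ℝ => t - t ^ 3 / 6 + 0.07 * t ^ 3 - Real.arsinh t)
      (Set.Icc 0 1) := by
    refine monotoneOn_of_hasDerivWithinAt_nonneg (convex_Icc 0 1)
      (fun t _ => (hd t).continuousAt.continuousWithinAt) (fun t _ => (hd t).hasDerivWithinAt) ?_
    intro t ht
    rw [interior_Icc] at ht
    have hu1 : t ^ 2 ≤ 1 := pow_le_one₀ ht.1.le ht.2.le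
    have hu0 : 0 ≤ t ^ 2 := sq_nonneg t
    generalize t ^ 2 = u at *
    have hpos : 0 < 1 - 0.29 * u := by linarith
    rw [sub_nonneg, inv_le_comm₀ (by positivity) hpos]
    refine Real.le_sqrt_of_sq_le ?_
    rw [inv_pow, inv_le_iff_one_le_mul₀ (by positivity)]
    nlinarith [mul_nonneg hu0 (sub_nonneg.2 hu1), mul_nonneg (mul_nonneg hu0 (sub_nonneg.2 hu1))
      (sub_nonneg.2 hu1)]
  have := hm (Set.mem_Icc.2 ⟨le_rfl, zero_le_one⟩) (Set.mem_Icc.2 ⟨hz, hz1⟩) hz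
  simp at this
  linarith

theorem existsUnique_isCubicRoot {g L : ℝ} (hg : g ∈ Set.Ioo (0 : ℝ) 1) (hL : 0 ≤ L)
    (h : L ≤ 1 - 5 / 6 * g) :
    (∃! S : ℝ, IsCubicRoot g L S) ∧ ∃ S ∈ Set.Icc (0 : ℝ) 1, IsCubicRoot g L S := by
  obtain ⟨hg0, hg1⟩ := hg
  have hex : ∃ S ∈ Set.Icc (0 : ℝ) 1, IsCubicRoot g L S := by
    have hc : ContinuousOn (fun S : ℝ => (1 - g) * S + g * (S ^ 3 / 6)) (Set.Icc 0 1) := by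
      fun_prop
    -- At `S = 1` the cubic equals `1 - 5/6 g`, the threshold of the last case.
    refine intermediate_value_Icc zero_le_one hc ⟨?_, ?_⟩
    · simpa using hL
    · norm_num
      linarith
  refine ⟨?_, hex⟩
  obtain ⟨S, -, hS⟩ := hex
  refine ⟨S, hS, fun T hT => ?_⟩
  have hmono : StrictMono (fun S : ℝ => (1 - g) * S + g * (S ^ 3 / 6)) := by
    intro a b hab
    have h3 : a ^ 3 < b ^ 3 := Odd.strictMono_pow (by decide) hab
    have h1 : (1 - g) * a < (1 - g) * b := mul_lt_mul_of_pos_left hab (by linarith)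
    have h2 : g * (a ^ 3 / 6) < g * (b ^ 3 / 6) := mul_lt_mul_of_pos_left (by linarith) hg0
    exact add_lt_add h1 h2
  exact hmono.injective (hT.trans hS.symm)

theorem isApproximateZero_of_isCubicRoot {g L z : ℝ} (hg : g ∈ Set.Ioo (0 : ℝ) 1)
    (hz : z ∈ Set.Icc (0 : ℝ) 1) (h : IsCubicRoot g L z) :
    IsApproximateZero (kepler g L) z := by
  obtain ⟨hg0, hg1⟩ := hg
  obtain ⟨hz0, hz1⟩ := hz
  have hα := alphaZero_gt
  have hk : kepler g L z = -(g * (Real.arsinh z - (z - z ^ 3 / 6))) := by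
    rw [kepler, ← show (1 - g) * z + g * (z ^ 3 / 6) = L from h]
    ring
  rcases hz0.eq_or_lt with rfl | hzpos
  · have hd : 0 < 1 - g := by linarith
    -- Here `f(0) = 0`, so the size of `M` is irrelevant to `α`; this one equals `1/(1 - g)`.
    apply isApproximateZero_kepler (M := 1 + g / (1 - g)) ⟨hg0, hg1⟩
    · linarith [div_pos hg0 hd]
    · simp
      positivity
    · simp only [ne_eq, OfNat.ofNat_ne_zero, not_false_eq_true, zero_pow, add_zero,
        Real.sqrt_one]
      have e : 1 + g / (1 - g) = 1 / (1 - g) := by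
        field_simp
        ring
      rw [e, div_pow, mul_assoc, one_pow, div_mul_eq_mul_div, one_mul, sq, div_mul_cancel_left₀ hd.ne',
        ← div_eq_mul_inv, le_div_iff₀ hd]
      nlinarith
    · rw [hk]
      simp
      nlinarith
  · have hr2 : √(1 + z ^ 2) ^ 2 = 1 + z ^ 2 := Real.sq_sqrt (by positivity)
    have hr := one_le_sqrt_one_add_sq z
    have hru : √(1 + z ^ 2) ≤ 1.4143 := by
      rw [Real.sqrt_le_left (by norm_num)]
      nlinarith
    have hlow := sub_cube_le_arsinh hz0
    have hup := arsinh_le_sub_cube hz0 hz1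
    have habs : |kepler g L z| ≤ g * (0.07 * z ^ 3) := by
      rw [hk, abs_neg, abs_mul, abs_of_pos hg0, abs_of_nonneg (by linarith)]
      gcongr
      linarith
    -- Use `z² = (r + 1)(r - 1)` and `g (r - 1) ≤ r - g`.
    have hz2 : g * z ^ 2 ≤ (√(1 + z ^ 2) + 1) * (√(1 + z ^ 2) - g) := by nlinarith
    apply isApproximateZero_kepler (M := 1 / z) ⟨hg0, hg1⟩
    · rwa [le_div_iff₀ hzpos, one_mul]
    · rw [abs_of_pos hzpos]
      generalize √(1 + z ^ 2) = r at *
      rw [show 2 * (1 / z) * r * (r - g) = 2 * r * (r - g) / z by ring, le_div_iff₀ hzpos]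
      nlinarith
    · generalize √(1 + z ^ 2) = r at *
      rw [show 3 * (1 / z) ^ 2 * (r - g) = 3 * (r - g) / z ^ 2 by ring,
        le_div_iff₀ (by positivity)]
      nlinarith
    · generalize √(1 + z ^ 2) = r at *
      calc |kepler g L z| * (1 / z) ≤ g * (0.07 * z ^ 3) * (1 / z) := by gcongr
        _ = 0.07 * (g * z ^ 2) := by field_simp
        _ ≤ 0.07 * ((r + 1) * (r - g)) := by gcongr
        _ < alphaZero * (r - g) := by nlinarith

end HyperbolicKepler

/-! ### Numerical verification and assembly -/

open HyperbolicKepler in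
theorem mainTheorem1 (g L : ℝ) (hg : g ∈ Set.Ioo (0 : ℝ) 1) (hL : 0 ≤ L) :
    (L ≤ 1 - 5 / 6 * g → ∃! S : ℝ, HyperbolicKepler.IsCubicRoot g L S) ∧
      HyperbolicKepler.IsApproximateZero (HyperbolicKepler.kepler g L)
        (HyperbolicKepler.starter g L) := by
  refine ⟨fun h => (existsUnique_isCubicRoot hg hL h).1, ?_⟩
  have ⟨hg0, hg1⟩ := hg
  have l1 : ((6 : ℕ) / (7 : ℕ) : ℝ) ≤ Real.arsinh 1 :=
    div_le_arsinh (r := 2.4) 6 7 (by norm_num) (by norm_num)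
      (Real.le_sqrt_of_sq_le (by norm_num)) (by norm_num)
  have l2 : ((19 : ℕ) / (20 : ℕ) : ℝ) ≤ Real.arsinh 1.12 :=
    div_le_arsinh (r := 2.62) 19 20 (by norm_num) (by norm_num)
      (Real.le_sqrt_of_sq_le (by norm_num)) (by norm_num)
  have l3 : ((16 : ℕ) / (15 : ℕ) : ℝ) ≤ Real.arsinh 1.32 :=
    div_le_arsinh (r := 2.97) 16 15 (by norm_num) (by norm_num)
      (Real.le_sqrt_of_sq_le (by norm_num)) (by norm_num)
  have l4 : ((6 : ℕ) / (5 : ℕ) : ℝ) ≤ Real.arsinh 1.60 :=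
    div_le_arsinh (r := 3.48) 6 5 (by norm_num) (by norm_num)
      (Real.le_sqrt_of_sq_le (by norm_num)) (by norm_num)
  have l5 : ((7 : ℕ) / (5 : ℕ) : ℝ) ≤ Real.arsinh 2.01 :=
    div_le_arsinh (r := 4.25) 7 5 (by norm_num) (by norm_num)
      (Real.le_sqrt_of_sq_le (by norm_num)) (by norm_num)
  have l6 : ((8 : ℕ) / (5 : ℕ) : ℝ) ≤ Real.arsinh 2.74 :=
    div_le_arsinh (r := 5.6) 8 5 (by norm_num) (by norm_num)
      (Real.le_sqrt_of_sq_le (by norm_num)) (by norm_num)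
  have l7 : ((2 : ℕ) / (1 : ℕ) : ℝ) ≤ Real.arsinh 4 :=
    div_le_arsinh (r := 8) 2 1 (by norm_num) (by norm_num)
      (Real.le_sqrt_of_sq_le (by norm_num)) (by norm_num)
  have u2 : Real.arsinh 1.12 ≤ ((39 : ℕ) / (40 : ℕ) : ℝ) :=
    arsinh_le_div (r := 2.63) 39 40 (by norm_num)
      ((Real.sqrt_le_left (by norm_num)).2 (by norm_num)) (by norm_num)
  have u3 : Real.arsinh 1.32 ≤ ((11 : ℕ) / (10 : ℕ) : ℝ) :=
    arsinh_le_div (r := 2.98) 11 10 (by norm_num)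
      ((Real.sqrt_le_left (by norm_num)).2 (by norm_num)) (by norm_num)
  have u4 : Real.arsinh 1.60 ≤ ((19 : ℕ) / (15 : ℕ) : ℝ) :=
    arsinh_le_div (r := 3.5) 19 15 (by norm_num)
      ((Real.sqrt_le_left (by norm_num)).2 (by norm_num)) (by norm_num)
  have u5 : Real.arsinh 2.01 ≤ ((22 : ℕ) / (15 : ℕ) : ℝ) :=
    arsinh_le_div (r := 4.26) 22 15 (by norm_num)
      ((Real.sqrt_le_left (by norm_num)).2 (by norm_num)) (by norm_num)
  have u6 : Real.arsinh 2.74 ≤ ((7 : ℕ) / (4 : ℕ) : ℝ) :=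
    arsinh_le_div (r := 5.7) 7 4 (by norm_num)
      ((Real.sqrt_le_left (by norm_num)).2 (by norm_num)) (by norm_num)
  have u7 : Real.arsinh 4 ≤ ((11 : ℕ) / (5 : ℕ) : ℝ) :=
    arsinh_le_div (r := 8.2) 11 5 (by norm_num)
      ((Real.sqrt_le_left (by norm_num)).2 (by norm_num)) (by norm_num)
  unfold starter
  -- In each linear case `z = L + c g` lies between consecutive breakpoints `1, 1.12, …, 4` (above
  -- `4` in the first), whatever `g` is: `c` is the coefficient in the upper bound on `L` and
  -- exceeds that in the lower one.
  split_ifs with h1 h2 h3 h4 h5 h6 h7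
  · refine isApproximateZero_of_abs_sub_arsinh_le hg rfl (by linarith)
      (abs_sub_arsinh_le_of_four_le (by linarith) (by simpa using l7))
  · exact isApproximateZero_of_abs_sub_arsinh_le hg rfl (by linarith)
      (abs_sub_arsinh_le (r := 2.9) (by norm_num) (by linarith) (by linarith) l6 u7
        (by norm_num) (by norm_num) (by norm_num))
  · exact isApproximateZero_of_abs_sub_arsinh_le hg rfl (by linarith)
      (abs_sub_arsinh_le (r := 2.24) (by norm_num) (by linarith) (by linarith) l5 u6
        (by norm_num) (by norm_num) (by norm_num))
  · exact isApproximateZero_of_abs_sub_arsinh_le hg rfl (by linarith)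
      (abs_sub_arsinh_le (r := 1.88) (by norm_num) (by linarith) (by linarith) l4 u5
        (by norm_num) (by norm_num) (by norm_num))
  · exact isApproximateZero_of_abs_sub_arsinh_le hg rfl (by linarith)
      (abs_sub_arsinh_le (r := 1.65) (by norm_num) (by linarith) (by linarith) l3 u4
        (by norm_num) (by norm_num) (by norm_num))
  · exact isApproximateZero_of_abs_sub_arsinh_le hg rfl (by linarith)
      (abs_sub_arsinh_le (r := 1.5) (by norm_num) (by linarith) (by linarith) l2 u3
        (by norm_num) (by norm_num) (by norm_num))
  · exact isApproximateZero_of_abs_sub_arsinh_le hg rfl (by linarith)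
      (abs_sub_arsinh_le (r := 1.41) (by norm_num) (by linarith) (by linarith) l1 u2
        (by norm_num) (by norm_num) (by norm_num))
  · obtain ⟨hu, S, hS, hroot⟩ := existsUnique_isCubicRoot hg hL (not_lt.1 h7)
    have hc : IsCubicRoot g L (cubicRoot g L) := Classical.epsilon_spec ⟨S, hroot⟩
    rw [hu.unique hc hroot]
    exact isApproximateZero_of_isCubicRoot hg hS hroot
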